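/- A matroid $\mathcal M$ on a finite set $E$ is regular if it is the column matroid over $\mathbb R$ of some $r\times E$ totally unimodular integer matrix $M$ of rank $r$ (such an $M$ is called a totally unimodular representation of $\mathcal M$). Given such an $M$, the lattice of integer flows is $\Lambda(\mathcal M)=\ker(M)\cap\mathbb Z^{E}$ and the lattice of integer cuts is $\Gamma(\mathcal M)=\mathrm{Row}(M)\cap\mathbb Z^{E}$, where $\ker(M)$ and $\mathrm{Row}(M)$ are the kernel and the row space of $M$ in $\mathbb R^{E}$; both lattices carry the bilinear form induced by the Euclidean dot product. Two lattices are isometric if there is an isomorphism of abelian groups between them that preserves the bilinear forms. For a matroid $\mathcal M$, let $\mathcal M_\bullet$ be the minor obtained by contracting all co-loops of $\mathcal M$, $\mathcal M^\circ$ the minor obtained by deleting all loops of $\mathcal M$, and $\mathcal M^*$ the dual matroid. **Corollary.** Let $\mathcal M$ and $\mathcal N$ be regular matroids. Then $(\mathcal N^\circ)^*=(\mathcal N^*)_\bullet$, and, for every choice of totally unimodular representations of $\mathcal M$ and $\mathcal N$, the lattices $\Lambda(\mathcal M)$ and $\Gamma(\mathcal N)$ are isometric if and only if $\mathcal M_\bullet$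 and $(\mathcal N^\circ)^*=(\mathcal N^*)_\bullet$ are isomorphic. -/

import Mathlib

open scoped Matrix

namespace Matroid

/-- An isomorphism of matroids exists: a bijection of the ground sets under which independent sets
correspond to independent sets. -/
def IsIsomorphic {α β : Type*} (M : Matroid α) (N : Matroid β) : Prop :=
  ∃ φ : M.E ≃ N.E, ∀ I : Set M.E,
    M.Indep (Subtype.val '' I) ↔ N.Indep (Subtype.val '' (φ '' I))

/-- The minor of `M` obtained by contracting all co-loops of `M`. -/
def contractColoops {α : Type*} (M : Matroid α) : Matroid α := M.contract M.coloops

/-- The minor of `M` obtained by deleting all loops of `M`. -/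
def deleteLoops {α : Type*} (M : Matroid α) : Matroid α := M.delete M.loops

/-- The integer matrix `A` (`r` rows, columns labelled by the ground set of `M`) is totally
unimodular, has rank `r`, and `M` is its column matroid over `ℝ`. -/
structure IsTURepresentation {α : Type*} (M : Matroid α) [Fintype M.E] {r : ℕ}
    (A : Matrix (Fin r) M.E ℤ) : Prop where
  isTotallyUnimodular : A.IsTotallyUnimodular
  rank_eq : (A.map (Int.cast : ℤ → ℝ)).rank = r
  indep_iff : ∀ I : Set M.E,
    M.Indep (Subtype.val '' I) ↔ LinearIndepOn ℝ (A.map (Int.cast : ℤ → ℝ)).col I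

/-- A regular matroid: the column matroid over `ℝ` of some `r`-by-`m` totally unimodular matrix of
rank `r`. -/
def IsRegular {α : Type*} (M : Matroid α) [Fintype M.E] : Prop :=
  ∃ (r : ℕ) (A : Matrix (Fin r) M.E ℤ), M.IsTURepresentation A

end Matroid

/-- The inclusion of `ℤ^E` in `ℝ^E`. -/
def intVecCast (E : Type*) : (E → ℤ) →+ (E → ℝ) := (Int.castAddHom ℝ).compLeft E

/-- The lattice of integer flows `ker A ∩ ℤ^E`, where `ker A` is the kernel in `ℝ^E`. -/
def flowLattice {r : ℕ} {E : Type*} [Fintype E] (A : Matrix (Fin r) E ℤ) : AddSubgroup (E → ℤ) :=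
  (LinearMap.ker (A.map (Int.cast : ℤ → ℝ)).mulVecLin).toAddSubgroup.comap (intVecCast E)

/-- The lattice of integer cuts `Row A ∩ ℤ^E`, where `Row A` is the row space in `ℝ^E`. -/
def cutLattice {r : ℕ} {E : Type*} (A : Matrix (Fin r) E ℤ) : AddSubgroup (E → ℤ) :=
  (Submodule.span ℝ (Set.range (A.map (Int.cast : ℤ → ℝ)).row)).toAddSubgroup.comap (intVecCast E)

/-- Two lattices of integer vectors, with the bilinear forms induced by the dot product, are
isometric: some isomorphism of abelian groups preserves the forms. -/
def LatticeIsometric {E F : Type*} [Fintype E] [Fintype F]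
    (L : AddSubgroup (E → ℤ)) (L' : AddSubgroup (F → ℤ)) : Prop :=
  ∃ ψ : L ≃+ L', ∀ x y : L, (ψ x : F → ℤ) ⬝ᵥ (ψ y : F → ℤ) = (x : E → ℤ) ⬝ᵥ (y : E → ℤ)

/-! Each of the two lattices consists of the integer points of a real subspace in which every vector
rounds to an integer vector of the subspace; this is where total unimodularity enters
(`exists_int_between_floor_ceil`). Rounding x/2 shows that every lattice vector x is congruent
modulo 2L to one with entries 0, 1 and -1. Hence the number of odd coordinates of x is the least
norm in x + 2L, which an isometry preserves. An isometry thus preserves the weights of the binary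
code L/2L, and the MacWilliams extension argument, by linear independence of characters
(`card_parityChar_eq_of_card_odd_eq`), gives a parity-preserving bijection of the coordinates that
do not vanish identically. Parities determine which sets support no nonzero lattice vector
(`supportIndep_iff_odd`). These sets are the independent sets of M for flows and of the dual of N
for cuts, and the identically vanishing coordinates are the co-loops.

Conversely, the independent sets determine the lattice up to signs of coordinates. A maximal one, B,
yields a lattice basis that is the identity outside B. The zero pattern of its entries inside B is
read off from basis exchanges, and by Camion's theorem (`exists_scaling`) that pattern fixes the
entries up to signs of rows and columns. Sign changes are isometries. -/

/-! ### Rounding in totally unimodular systems -/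

namespace Matrix

/-- Real coefficients expressing an integer vector through linearly independent columns of a
totally unimodular matrix are integers. -/
theorem IsTotallyUnimodular.exists_int_of_linearIndependent_col {m ι : Type*} [Fintype m]
    [Fintype ι] {A : Matrix m ι ℤ} (hA : A.IsTotallyUnimodular)
    (hli : LinearIndependent ℝ (A.map (Int.cast : ℤ → ℝ)).col) {z : ι → ℝ} {b : m → ℤ}
    (hz : A.map (Int.cast : ℤ → ℝ) *ᵥ z = fun i => (b i : ℝ)) :
    ∃ w : ι → ℤ, ∀ e, z e = w e := by
  classical
  have hrank : (A.map (Int.cast : ℤ → ℝ)).rank = Fintype.card ι := by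
    rw [← rank_transpose]
    exact LinearIndependent.rank_matrix (M := (A.map (Int.cast : ℤ → ℝ))ᵀ) hli
  obtain ⟨κ, a, ha, hspan, hli'⟩ := exists_linearIndependent' ℝ (A.map (Int.cast : ℤ → ℝ)).row
  have : Fintype κ := Fintype.ofInjective a ha
  have hcard : Fintype.card ι = Fintype.card κ := by
    rw [← hrank, rank_eq_finrank_span_row, ← hspan,
      linearIndependent_iff_card_eq_finrank_span.mp hli', Set.finrank]
  let σ : ι ≃ κ := Fintype.equivOfCardEq hcard
  -- A nonsingular square block of full column rank: total unimodularity makes its determinant a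
  -- unit, so its inverse is integral.
  let S : Matrix ι ι ℤ := A.submatrix (a ∘ σ) id
  have hS : LinearIndependent ℝ (S.map (Int.cast : ℤ → ℝ)).row :=
    hli'.comp σ σ.injective
  have hdet : IsUnit S.det := by
    have h1 : (S.map (Int.cast : ℤ → ℝ)).det ≠ 0 := by
      rw [linearIndependent_rows_iff_isUnit, isUnit_iff_isUnit_det] at hS
      exact hS.ne_zero
    have h2 : S.det ≠ 0 := by
      intro h
      apply h1
      have := RingHom.map_det (Int.castRingHom ℝ) S
      rw [h] at this
      simpa using this.symm
    obtain ⟨s, hs⟩ := (isTotallyUnimodular_iff_fintype A).1 hA ι (a ∘ σ) id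
    change _ = S.det at hs
    rw [Int.isUnit_iff, ← hs]
    rw [← hs] at h2
    revert h2
    cases s <;> simp
  refine ⟨S⁻¹ *ᵥ fun i => b (a (σ i)), ?_⟩
  have hSz : S.map (Int.cast : ℤ → ℝ) *ᵥ z = fun i => ((b (a (σ i)) : ℤ) : ℝ) := by
    ext i
    exact congrFun hz (a (σ i))
  have hinv : S⁻¹.map (Int.cast : ℤ → ℝ) * S.map (Int.cast : ℤ → ℝ) = 1 := by
    calc _ = (S⁻¹ * S).map (Int.castRingHom ℝ) := Matrix.map_mul.symm
      _ = 1 := by rw [nonsing_inv_mul S hdet]; exact Matrix.map_one _ (by simp) (by simp)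
  intro e
  have h := congrArg (fun v => S⁻¹.map (Int.cast : ℤ → ℝ) *ᵥ v) hSz
  simp only [mulVec_mulVec, hinv, one_mulVec] at h
  rw [h]
  simp [mulVec, dotProduct]

/-- A real solution of an integral totally unimodular system rounds to an integer solution. -/
theorem IsTotallyUnimodular.exists_int_between_floor_ceil {m n : Type*} [Fintype m] [Fintype n]
    {A : Matrix m n ℤ} (hA : A.IsTotallyUnimodular) {b : m → ℤ} (z : n → ℝ)
    (hz : A.map (Int.cast : ℤ → ℝ) *ᵥ z = fun i => (b i : ℝ)) :
    ∃ w : n → ℤ, A *ᵥ w = b ∧ ∀ e, ⌊z e⌋ ≤ w e ∧ w e ≤ ⌈z e⌉ := by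
  classical
  induction hk : (Finset.univ.filter fun e => (⌊z e⌋ : ℝ) ≠ z e).card using Nat.strong_induction_on
    generalizing z with
  | _ k ih =>
  -- Induction on the number of non-integral coordinates. If their columns are independent, there
  -- are none; otherwise `z` moves along a kernel vector supported on `J` until a coordinate becomes
  -- integral.
  let J : Set n := {e | (⌊z e⌋ : ℝ) ≠ z e}
  by_cases hJ : LinearIndepOn ℝ (A.map (Int.cast : ℤ → ℝ)).col J
  · have hint : ∃ w : J → ℤ, ∀ e : J, z e = w e := by
      refine (hA.submatrix id (Subtype.val : J → n)).exists_int_of_linearIndependent_col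
        (b := fun i => b i - ∑ e : {e // e ∉ J}, A i e * ⌊z e⌋) hJ ?_
      ext i
      have h := congrFun hz i
      simp only [mulVec, dotProduct, map_apply] at h
      rw [← Fintype.sum_subtype_add_sum_subtype (fun e => e ∈ J)] at h
      have h2 : ∀ e : {e // e ∉ J}, (⌊z e⌋ : ℝ) = z e := fun e => not_not.1 e.2
      push_cast
      simp only [h2, ← h]
      simp [mulVec, dotProduct]
    obtain ⟨w, hw⟩ := hint
    have hfl : ∀ e, (⌊z e⌋ : ℝ) = z e := by
      intro e
      by_contra he
      have := hw ⟨e, he⟩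
      simp only at this
      rw [this] at he
      simp at he
    refine ⟨fun e => ⌊z e⌋, ?_, fun e => ⟨le_rfl, Int.floor_le_ceil _⟩⟩
    ext i
    have h : ∑ e, (A i e : ℝ) * ⌊z e⌋ = b i := by
      simpa only [hfl, mulVec, dotProduct, map_apply] using congrFun hz i
    exact_mod_cast h
  · obtain ⟨w, hwJ, hw0, hw⟩ : ∃ w : n → ℝ, (∀ e, w e ≠ 0 → e ∈ J) ∧
        A.map (Int.cast : ℤ → ℝ) *ᵥ w = 0 ∧ ∃ e, w e ≠ 0 := by
      rw [LinearIndepOn, Fintype.linearIndependent_iff] at hJ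
      push Not at hJ
      obtain ⟨g, hg, e, he⟩ := hJ
      refine ⟨fun e => if h : e ∈ J then g ⟨e, h⟩ else 0, ?_, ?_, e, ?_⟩
      · intro e h
        by_contra h'
        simp [h'] at h
      · ext i
        have h := congrFun hg i
        simp only [mulVec, dotProduct, map_apply]
        rw [← Fintype.sum_subtype_add_sum_subtype (fun e => e ∈ J)]
        have h1 : ∀ e : {e // e ∉ J}, (if h : (e : n) ∈ J then g ⟨e, h⟩ else 0) = 0 :=
          fun e => dif_neg e.2
        have h2 : ∀ e : {e // e ∈ J}, (if h : (e : n) ∈ J then g ⟨e, h⟩ else 0) = g e :=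
          fun e => dif_pos e.2
        simp only [h1, h2]
        simpa [Finset.sum_apply, mul_comm] using h
      · simpa using he
    -- The time at which coordinate `e`, moving at speed `w e`, reaches its ceiling or floor.
    -- Coordinates with `w e = 0` are left out of the minimum.
    let T : n → ℝ := fun e => if 0 < w e then (⌈z e⌉ - z e) / w e else (⌊z e⌋ - z e) / w e
    obtain ⟨e₀, he₀, hmin⟩ := (Finset.univ.filter fun e => w e ≠ 0).exists_min_image T
      (by obtain ⟨e, he⟩ := hw; exact ⟨e, by simpa using he⟩)
    simp only [Finset.mem_filter, Finset.mem_univ, true_and] at he₀ hmin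
    let z' : n → ℝ := fun e => z e + T e₀ * w e
    have hT : 0 ≤ T e₀ := by
      simp only [T]
      split_ifs with h
      · exact div_nonneg (by linarith [Int.le_ceil (z e₀)]) h.le
      · exact div_nonneg_of_nonpos (by linarith [Int.floor_le (z e₀)]) (not_lt.1 h)
    have hle : ∀ e, (⌊z e⌋ : ℝ) ≤ z' e ∧ z' e ≤ ⌈z e⌉ := by
      intro e
      have h1 := Int.floor_le (z e)
      have h2 := Int.le_ceil (z e)
      rcases lt_trichotomy (w e) 0 with h | h | h
      · have h3 := hmin e h.ne
        simp only [T, not_lt.2 h.le, if_false] at h3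
        rw [le_div_iff_of_neg h] at h3
        refine ⟨?_, ?_⟩ <;> simp only [z', T] <;> nlinarith
      · simp only [z', h]; constructor <;> linarith
      · have h3 := hmin e h.ne'
        simp only [T, h, if_true] at h3
        rw [le_div_iff₀ h] at h3
        refine ⟨?_, ?_⟩ <;> simp only [z', T] <;> nlinarith
    have hz0 : (⌊z' e₀⌋ : ℝ) = z' e₀ := by
      have : (∃ k : ℤ, z' e₀ = k) := by
        simp only [z', T]
        split_ifs with h
        · exact ⟨⌈z e₀⌉, by field_simp; ring⟩
        · exact ⟨⌊z e₀⌋, by field_simp; ring⟩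
      obtain ⟨k, hk⟩ := this
      rw [hk]; simp
    have hz' : A.map (Int.cast : ℤ → ℝ) *ᵥ z' = fun i => (b i : ℝ) := by
      have : z' = z + T e₀ • w := by ext e; simp [z']
      rw [this, mulVec_add, mulVec_smul, hw0, hz]
      simp
    have hlt : (Finset.univ.filter fun e => (⌊z' e⌋ : ℝ) ≠ z' e).card < k := by
      rw [← hk]
      apply Finset.card_lt_card
      refine ⟨fun e he => ?_, fun h => ?_⟩
      · simp only [Finset.mem_filter, Finset.mem_univ, true_and] at he ⊢
        intro h
        have : w e = 0 := by
          by_contra h'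
          exact hwJ e h' h
        apply he
        simp [z', this, h]
      · have := h (Finset.mem_filter.2 ⟨Finset.mem_univ e₀, hwJ e₀ he₀⟩)
        simp [hz0] at this
    obtain ⟨v, hv, hvz⟩ := ih _ hlt z' hz' rfl
    exact ⟨v, hv, fun e => ⟨(Int.le_floor.2 (hle e).1).trans (hvz e).1,
        (hvz e).2.trans (Int.ceil_le.2 (hle e).2)⟩⟩

end Matrix

/-! ### Regular lattices and rounding -/

/-- A lattice of integer vectors is regular if it is closed under halving and each of its vectors is
congruent modulo two to a vector of the lattice with entries `0`, `1` and `-1`. -/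
structure AddSubgroup.IsRegularLattice {E : Type*} (L : AddSubgroup (E → ℤ)) : Prop where
  mem_of_two_nsmul_mem : ∀ x, 2 • x ∈ L → x ∈ L
  exists_abs_le_one : ∀ x ∈ L, ∃ y ∈ L, (∀ e, |y e| ≤ 1) ∧ ∀ e, (2 : ℤ) ∣ x e - y e

/-- A set of coordinates is independent for a lattice if it supports no nonzero lattice vector. -/
def AddSubgroup.SupportIndep {E : Type*} (L : AddSubgroup (E → ℤ)) (I : Set E) : Prop :=
  ∀ x ∈ L, (∀ e ∉ I, x e = 0) → x = 0

/-- Every vector of the subspace rounds to an integer vector of the subspace. -/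
def Submodule.HasRounding {E : Type*} (V : Submodule ℝ (E → ℝ)) : Prop :=
  ∀ z ∈ V, ∃ w : E → ℤ, intVecCast E w ∈ V ∧ ∀ e, ⌊z e⌋ ≤ w e ∧ w e ≤ ⌈z e⌉

theorem intVecCast_apply {E : Type*} (x : E → ℤ) (e : E) : intVecCast E x e = x e := rfl

namespace Submodule.HasRounding

variable {E : Type*} {V : Submodule ℝ (E → ℝ)}

/-- If `w` rounds `x / 2`, then `x - 2 • w` has entries of absolute value less than 2. -/
theorem isRegularLattice (hV : V.HasRounding) :
    (V.toAddSubgroup.comap (intVecCast E)).IsRegularLattice where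
  mem_of_two_nsmul_mem x hx := by
    simp only [AddSubgroup.mem_comap, map_nsmul, mem_toAddSubgroup] at hx ⊢
    have h := V.smul_mem (1 / 2 : ℝ) hx
    convert h using 1
    ext e
    simp [intVecCast_apply]
  exists_abs_le_one x hx := by
    simp only [AddSubgroup.mem_comap, mem_toAddSubgroup] at hx
    obtain ⟨w, hwV, hw⟩ := hV _ (V.smul_mem (1 / 2 : ℝ) hx)
    refine ⟨x - 2 • w, ?_, fun e => ?_, fun e => ?_⟩
    · simp only [AddSubgroup.mem_comap, map_sub, map_nsmul, mem_toAddSubgroup]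
      exact V.sub_mem hx (V.nsmul_mem hwV 2)
    · obtain ⟨h1, h2⟩ := hw e
      simp only [Pi.smul_apply, intVecCast_apply, smul_eq_mul] at h1 h2
      have h3 := Int.sub_one_lt_floor (1 / 2 * (x e : ℝ))
      have h4 := Int.ceil_lt_add_one (1 / 2 * (x e : ℝ))
      have h5 : ((⌊1 / 2 * (x e : ℝ)⌋ : ℤ) : ℝ) ≤ w e := by exact_mod_cast h1
      have h6 : (w e : ℝ) ≤ (⌈1 / 2 * (x e : ℝ)⌉ : ℤ) := by exact_mod_cast h2
      have h7 : x e - 2 * w e < 2 := by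
        have : (x e : ℝ) - 2 * w e < 2 := by linarith
        exact_mod_cast this
      have h8 : -2 < x e - 2 * w e := by
        have : -2 < (x e : ℝ) - 2 * w e := by linarith
        exact_mod_cast this
      have h9 : (x - 2 • w) e = x e - 2 * w e := by simp
      rw [h9, abs_le]
      omega
    · simp

/-- Rounding keeps integral coordinates, so a real vector scaled to have some coordinate 1 rounds to
a nonzero integer vector without new support. -/
theorem supportIndep_iff (hV : V.HasRounding) (I : Set E) :
    (V.toAddSubgroup.comap (intVecCast E)).SupportIndep I ↔
      ∀ z ∈ V, (∀ e ∉ I, z e = 0) → z = 0 := by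
  refine ⟨fun h z hz hI => ?_, fun h x hx hI => ?_⟩
  · by_contra hne
    obtain ⟨e, he⟩ := Function.ne_iff.1 hne
    obtain ⟨w, hwV, hw⟩ := hV _ (V.smul_mem (z e)⁻¹ hz)
    have hw0 := h w hwV fun e' he' => by
      have := hw e'
      simp only [Pi.smul_apply, hI e' he', smul_zero, Int.floor_zero, Int.ceil_zero] at this
      omega
    have := hw e
    rw [hw0] at this
    simp [inv_mul_cancel₀ he] at this
  · have := h _ hx fun e he => by simp [intVecCast_apply, hI e he]
    ext e
    have := congrFun this e
    simpa [intVecCast_apply] using this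

end Submodule.HasRounding

theorem hasRounding_ker {r : ℕ} {E : Type*} [Fintype E] {A : Matrix (Fin r) E ℤ}
    (hA : A.IsTotallyUnimodular) :
    (LinearMap.ker (A.map (Int.cast : ℤ → ℝ)).mulVecLin).HasRounding := by
  intro z hz
  obtain ⟨w, hw, hwz⟩ := hA.exists_int_between_floor_ceil (b := 0) z (by
    rw [LinearMap.mem_ker, Matrix.mulVecLin_apply] at hz
    rw [hz]; ext; simp)
  refine ⟨w, ?_, hwz⟩
  rw [LinearMap.mem_ker, Matrix.mulVecLin_apply]
  ext i
  have := congrFun hw i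
  simp only [Matrix.mulVec, dotProduct, Matrix.map_apply, intVecCast_apply, Pi.zero_apply] at this ⊢
  exact_mod_cast this

theorem mem_span_row_iff {r : ℕ} {E : Type*} {A : Matrix (Fin r) E ℝ} {z : E → ℝ} :
    z ∈ Submodule.span ℝ (Set.range A.row) ↔ ∃ p, p ᵥ* A = z := by
  rw [← range_vecMulLinear, LinearMap.mem_range]
  rfl

/-- The pair (p, -pA) lies in the kernel of the totally unimodular matrix [Aᵀ | 1]; rounding it
there rounds the coefficients and the row vector simultaneously. -/
theorem hasRounding_span_row {r : ℕ} {E : Type*} [Fintype E] {A : Matrix (Fin r) E ℤ}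
    (hA : A.IsTotallyUnimodular) :
    (Submodule.span ℝ (Set.range (A.map (Int.cast : ℤ → ℝ)).row)).HasRounding := by
  classical
  intro z hz
  obtain ⟨p, rfl⟩ := mem_span_row_iff.1 hz
  have hT := (Matrix.fromCols_one_isTotallyUnimodular_iff Aᵀ).2 hA.transpose
  obtain ⟨w, hw, hwz⟩ := hT.exists_int_between_floor_ceil (b := 0)
    (Sum.elim p (-(p ᵥ* A.map (Int.cast : ℤ → ℝ)))) (by
      rw [Matrix.fromCols_map, Matrix.fromCols_mulVec]
      ext e
      simp [Matrix.mulVec_transpose, Matrix.transpose_map])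
  rw [Matrix.fromCols_mulVec, Matrix.one_mulVec, Matrix.mulVec_transpose] at hw
  refine ⟨-(w ∘ Sum.inr), ?_, fun e => ?_⟩
  · refine mem_span_row_iff.2 ⟨fun i => w (Sum.inl i), ?_⟩
    rw [← eq_neg_iff_add_eq_zero] at hw
    rw [← hw]
    ext e
    simp [Matrix.vecMul, dotProduct, intVecCast_apply]
  · have := hwz (Sum.inr e)
    simp only [Sum.elim_inr, Pi.neg_apply, Int.floor_neg, Int.ceil_neg] at this
    simp only [Pi.neg_apply, Function.comp_apply]
    omega

theorem isRegularLattice_flowLattice {r : ℕ} {E : Type*} [Fintype E] {A : Matrix (Fin r) E ℤ}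
    (hA : A.IsTotallyUnimodular) : (flowLattice A).IsRegularLattice :=
  (hasRounding_ker hA).isRegularLattice

theorem isRegularLattice_cutLattice {r : ℕ} {E : Type*} [Fintype E] {A : Matrix (Fin r) E ℤ}
    (hA : A.IsTotallyUnimodular) : (cutLattice A).IsRegularLattice :=
  (hasRounding_span_row hA).isRegularLattice

theorem supportIndep_flowLattice_iff {r : ℕ} {E : Type*} [Fintype E] {A : Matrix (Fin r) E ℤ}
    (hA : A.IsTotallyUnimodular) (I : Set E) :
    (flowLattice A).SupportIndep I ↔ LinearIndepOn ℝ (A.map (Int.cast : ℤ → ℝ)).col I := by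
  classical
  refine ((hasRounding_ker hA).supportIndep_iff I).trans ?_
  rw [LinearIndepOn, Fintype.linearIndependent_iff]
  simp only [LinearMap.mem_ker, Matrix.mulVecLin_apply]
  have key : ∀ z : E → ℝ, (∀ e ∉ I, z e = 0) →
      A.map (Int.cast : ℤ → ℝ) *ᵥ z = ∑ e : I, z e • (A.map (Int.cast : ℤ → ℝ)).col e := by
    intro z hz
    ext i
    simp only [Matrix.mulVec, dotProduct, Matrix.map_apply]
    rw [← Fintype.sum_subtype_add_sum_subtype (fun e => e ∈ I)]
    have h1 : ∀ e : {e // e ∉ I}, z e = 0 := fun e => hz e e.2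
    simp [h1, Finset.sum_apply, mul_comm]
  constructor
  · intro h g hg e
    let z : E → ℝ := fun e => if h : e ∈ I then g ⟨e, h⟩ else 0
    have hzI : ∀ e ∉ I, z e = 0 := fun e he => dif_neg he
    have hzg : ∀ e : I, z e = g e := fun e => dif_pos e.2
    have := h z (by rw [key z hzI]; simpa only [hzg] using hg) hzI
    rw [← hzg, this]; rfl
  · intro h z hz hzI
    rw [key z hzI] at hz
    ext e
    by_cases he : e ∈ I
    · exact h (fun e => z e) hz ⟨e, he⟩
    · exact hzI e he

/-! ### Parity in regular lattices -/

namespace AddSubgroup.IsRegularLattice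

variable {E F : Type*} {L : AddSubgroup (E → ℤ)} {L' : AddSubgroup (F → ℤ)}

theorem exists_two_nsmul (hL : L.IsRegularLattice) {x : E → ℤ} (hx : x ∈ L)
    (h : ∀ e, (2 : ℤ) ∣ x e) : ∃ z ∈ L, x = 2 • z := by
  choose z hz using h
  have h2 : x = 2 • z := by ext e; simp [hz]
  exact ⟨z, hL.mem_of_two_nsmul_mem z (h2 ▸ hx), h2⟩

theorem exists_reduced (hL : L.IsRegularLattice) {x : E → ℤ} (hx : x ∈ L) :
    ∃ y ∈ L, (∀ e, |y e| ≤ 1) ∧ (∀ e, (2 : ℤ) ∣ x e - y e) ∧ ∀ e, y e ≠ 0 ↔ Odd (x e) := by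
  obtain ⟨y, hy, h1, h2⟩ := hL.exists_abs_le_one x hx
  refine ⟨y, hy, h1, h2, fun e => ?_⟩
  have h3 := h1 e
  have h4 := h2 e
  rw [abs_le] at h3
  rw [Int.odd_iff]
  omega

/-- While `x e` is even, subtracting the reduced representative and halving keeps `e` in the
support, adds nothing to the support, and halves `x e`. -/
theorem exists_odd (hL : L.IsRegularLattice) {x : E → ℤ} (hx : x ∈ L) {e : E} (he : x e ≠ 0) :
    ∃ z ∈ L, (∀ e', x e' = 0 → z e' = 0) ∧ Odd (z e) := by
  induction hk : (x e).natAbs using Nat.strong_induction_on generalizing x with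
  | _ k ih =>
  by_cases hodd : Odd (x e)
  · exact ⟨x, hx, fun _ h => h, hodd⟩
  obtain ⟨y, hy, -, h2, hy0⟩ := hL.exists_reduced hx
  obtain ⟨z, hz, hxz⟩ := hL.exists_two_nsmul (L.sub_mem hx hy) h2
  have hz' : ∀ e', x e' - y e' = 2 * z e' := fun e' => by simpa using congrFun hxz e'
  have hye : y e = 0 := by by_contra h; exact hodd ((hy0 e).1 h)
  have h3 := hz' e
  obtain ⟨v, hv, hv0, hve⟩ := ih _ (by omega) hz (by omega) rfl
  refine ⟨v, hv, fun e' he' => hv0 e' ?_, hve⟩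
  have h4 : y e' = 0 := by
    by_contra h
    have := (hy0 e').1 h
    rw [he'] at this
    simp at this
  have := hz' e'
  omega

theorem exists_odd_iff (hL : L.IsRegularLattice) (e : E) :
    (∃ x ∈ L, Odd (x e)) ↔ ∃ x ∈ L, x e ≠ 0 := by
  refine ⟨fun ⟨x, hx, h⟩ => ⟨x, hx, fun h0 => by simp [h0] at h⟩, fun ⟨x, hx, h⟩ => ?_⟩
  obtain ⟨z, hz, -, h⟩ := hL.exists_odd hx h
  exact ⟨z, hz, h⟩

/-- Independence depends only on the lattice modulo two: a reduced vector is supported exactly on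
the odd coordinates, and `exists_odd` makes a nonzero coordinate odd. -/
theorem supportIndep_iff_odd (hL : L.IsRegularLattice) (I : Set E) :
    L.SupportIndep I ↔ ∀ x ∈ L, (∀ e ∉ I, ¬ Odd (x e)) → ∀ e, ¬ Odd (x e) := by
  refine ⟨fun h x hx hI e he => ?_, fun h x hx hI => ?_⟩
  · obtain ⟨y, hy, -, -, hy0⟩ := hL.exists_reduced hx
    have := h y hy fun e he => by
      by_contra h'
      exact hI e he ((hy0 e).1 h')
    exact (hy0 e).2 he (by rw [this]; rfl)
  · ext e
    by_contra he
    obtain ⟨z, hz, hz0, hze⟩ := hL.exists_odd hx he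
    exact h z hz (fun e' he' => by simp [hz0 e' (hI e' he')]) e hze

theorem forall_not_odd_iff (x : L) : (∀ e, ¬ Odd ((x : E → ℤ) e)) ↔
    ∀ e : {e // ∃ x ∈ L, x e ≠ 0}, ¬ Odd ((x : E → ℤ) e) :=
  ⟨fun h e => h e, fun h e ho => h ⟨e, x, x.2, fun h0 => by simp [h0] at ho⟩ ho⟩

theorem forall_notMem_image_not_odd_iff (J : Set {e // ∃ x ∈ L, x e ≠ 0}) (x : L) :
    (∀ e ∉ Subtype.val '' J, ¬ Odd ((x : E → ℤ) e)) ↔ ∀ e ∉ J, ¬ Odd ((x : E → ℤ) e) := by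
  refine ⟨fun h e he => h e ?_, fun h e he ho => ?_⟩
  · rintro ⟨e', he', h'⟩
    exact he (Subtype.ext h' ▸ he')
  · exact h ⟨e, x, x.2, fun h0 => by simp [h0] at ho⟩ (fun hJ => he ⟨_, hJ, rfl⟩) ho

variable [Fintype E] [Fintype F]

theorem card_odd_le_dotProduct (x : E → ℤ) :
    ((Finset.univ.filter fun e => Odd (x e)).card : ℤ) ≤ x ⬝ᵥ x := by
  rw [Finset.card_filter, Nat.cast_sum]
  refine Finset.sum_le_sum fun e _ => ?_
  split_ifs with h
  · have : x e ≠ 0 := fun h0 => by simp [h0] at h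
    have := mul_self_pos.2 this
    simp only [Nat.cast_one]
    omega
  · simpa using mul_self_nonneg (x e)

/-- The reduced representative of `x` has norm equal to the odd count of `x`; its image has the same
norm and the parities of `ψ x`, and a norm is at least the odd count. -/
theorem card_odd_le_of_latticeIsometric (hL : L.IsRegularLattice) (ψ : L ≃+ L')
    (hψ : ∀ x y : L, (ψ x : F → ℤ) ⬝ᵥ (ψ y : F → ℤ) = (x : E → ℤ) ⬝ᵥ (y : E → ℤ)) (x : L) :
    (Finset.univ.filter fun f => Odd ((ψ x : F → ℤ) f)).card ≤
      (Finset.univ.filter fun e => Odd ((x : E → ℤ) e)).card := by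
  obtain ⟨y, hy, h1, h2, hy0⟩ := hL.exists_reduced x.2
  obtain ⟨z, hz, hxz⟩ := hL.exists_two_nsmul (L.sub_mem x.2 hy) h2
  have hx : x = ⟨y, hy⟩ + 2 • (⟨z, hz⟩ : L) := by
    ext1
    simp [← hxz]
  have hpar : ∀ f, Odd ((ψ x : F → ℤ) f) ↔ Odd ((ψ ⟨y, hy⟩ : F → ℤ) f) := by
    intro f
    rw [hx, map_add, map_nsmul]
    simp [Int.odd_add]
  have hnorm : y ⬝ᵥ y = ((Finset.univ.filter fun e => Odd ((x : E → ℤ) e)).card : ℤ) := by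
    rw [Finset.card_filter, Nat.cast_sum]
    refine Finset.sum_congr rfl fun e _ => ?_
    have h3 := h1 e
    have h4 := hy0 e
    split_ifs with h
    · have := h4.2 h
      rcases lt_or_gt_of_ne this with h5 | h5
      · have : y e = -1 := by rw [abs_le] at h3; omega
        simp [this]
      · have : y e = 1 := by rw [abs_le] at h3; omega
        simp [this]
    · have : y e = 0 := by by_contra h'; exact h (h4.1 h')
      simp [this]
  have := card_odd_le_dotProduct (ψ ⟨y, hy⟩ : F → ℤ)
  rw [hψ, hnorm] at this
  simp only [hpar]
  exact_mod_cast this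

end AddSubgroup.IsRegularLattice

/-! ### Isometries induce bijections of coordinates -/

/-- Two families with equally large fibres over the points with property `P` are matched by a
bijection of the indices of these points. -/
theorem exists_equiv_of_card_fiber_eq {E F X : Type*} [Fintype E] [Fintype F] (u : E → X)
    (v : F → X) (P : X → Prop)
    (h : ∀ c, P c → Nat.card {e // u e = c} = Nat.card {f // v f = c}) :
    ∃ φ : {e // P (u e)} ≃ {f // P (v f)}, ∀ e, v (φ e) = u e := by
  let u' : {e // P (u e)} → {c // P c} := fun e => ⟨u e, e.2⟩
  let v' : {f // P (v f)} → {c // P c} := fun f => ⟨v f, f.2⟩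
  let a : ∀ c, {e // u' e = c} ≃ {e // u e = c} := fun c =>
    ⟨fun e => ⟨e.1, congrArg Subtype.val e.2⟩,
      fun e => ⟨⟨e.1, by rw [e.2]; exact c.2⟩, Subtype.ext e.2⟩, fun _ => rfl, fun _ => rfl⟩
  let b : ∀ c, {f // v' f = c} ≃ {f // v f = c} := fun c =>
    ⟨fun f => ⟨f.1, congrArg Subtype.val f.2⟩,
      fun f => ⟨⟨f.1, by rw [f.2]; exact c.2⟩, Subtype.ext f.2⟩, fun _ => rfl, fun _ => rfl⟩
  have g : ∀ c, Nonempty ({e // u' e = c} ≃ {f // v' f = c}) := fun c =>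
    ⟨(a c).trans ((Finite.card_eq.1 (h c c.2)).some.trans (b c).symm)⟩
  refine ⟨(Equiv.sigmaFiberEquiv u').symm.trans
    ((Equiv.sigmaCongrRight fun c => (g c).some).trans (Equiv.sigmaFiberEquiv v')), fun e => ?_⟩
  exact congrArg Subtype.val ((g (u' e)).some ⟨e, rfl⟩).2

namespace AddSubgroup.IsRegularLattice

variable {E F : Type*} [Fintype E] [Fintype F] {L : AddSubgroup (E → ℤ)} {L' : AddSubgroup (F → ℤ)}

/-- The parity character of a coordinate. -/
def parityChar {G : Type*} [AddGroup G] (f : G →+ ℤ) : Multiplicative G →* ℤ where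
  toFun x := ((f x.toAdd).negOnePow : ℤ)
  map_one' := by simp
  map_mul' x y := by simp [Int.negOnePow_add]

theorem parityChar_apply {G : Type*} [AddGroup G] (f : G →+ ℤ) (x : G) :
    parityChar f (Multiplicative.ofAdd x) = 1 - 2 * if Odd (f x) then 1 else 0 := by
  change ((f x).negOnePow : ℤ) = _
  split_ifs with h
  · simp [Int.negOnePow_odd _ h]
  · simp [Int.negOnePow_even _ (Int.not_odd_iff_even.1 h)]

theorem card_parityChar_eq_of_card_odd_eq {G : Type*} [AddGroup G] (u : E → G →+ ℤ)
    (v : F → G →+ ℤ)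
    (h : ∀ x, (Finset.univ.filter fun e => Odd (u e x)).card =
      (Finset.univ.filter fun f => Odd (v f x)).card)
    {c : Multiplicative G →* ℤ} (hc : c ≠ 1) :
    Nat.card {e // parityChar (u e) = c} = Nat.card {f // parityChar (v f) = c} := by
  classical
  -- The multiples of the trivial character compensate for `E` and `F` possibly differing in size;
  -- they do not affect the coefficient of `c ≠ 1`.
  let l : (Multiplicative G →* ℤ) →₀ ℤ :=
    (∑ e, Finsupp.single (parityChar (u e)) 1 + Finsupp.single 1 (Fintype.card F : ℤ)) -
      (∑ f, Finsupp.single (parityChar (v f)) 1 + Finsupp.single 1 (Fintype.card E : ℤ))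
  have hl : l = 0 := by
    refine linearIndependent_iff.1 (linearIndependent_monoidHom (Multiplicative G) ℤ) l ?_
    ext x
    have hx : (∑ e, if Odd (u e x.toAdd) then (1 : ℤ) else 0) =
        ∑ f, if Odd (v f x.toAdd) then (1 : ℤ) else 0 := by
      have := h x.toAdd
      rw [Finset.card_filter, Finset.card_filter] at this
      exact_mod_cast this
    have hu : ∀ e, parityChar (u e) x = 1 - 2 * if Odd (u e x.toAdd) then 1 else 0 :=
      fun e => parityChar_apply (u e) x.toAdd
    have hv : ∀ f, parityChar (v f) x = 1 - 2 * if Odd (v f x.toAdd) then 1 else 0 :=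
      fun f => parityChar_apply (v f) x.toAdd
    simp only [l, map_sub, map_add, map_sum, Finsupp.linearCombination_single, Pi.sub_apply,
      Pi.add_apply, Finset.sum_apply, Pi.smul_apply, one_smul, MonoidHom.one_apply, hu, hv,
      Finset.sum_sub_distrib, ← Finset.mul_sum, hx]
    simp
    ring
  have := DFunLike.congr_fun hl c
  simp only [l, Finsupp.sub_apply, Finsupp.add_apply, Finsupp.finsetSum_apply,
    Finsupp.single_apply, hc.symm, if_false, add_zero, Finsupp.zero_apply] at this
  rw [Nat.card_eq_fintype_card, Nat.card_eq_fintype_card, Fintype.card_subtype,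
    Fintype.card_subtype, Finset.card_filter, Finset.card_filter]
  zify
  linarith

/-- An isometry of regular lattices is induced, modulo two, by a bijection of the coordinates that
do not vanish identically. -/
theorem exists_equiv_of_latticeIsometric (hL : L.IsRegularLattice) (hL' : L'.IsRegularLattice)
    (h : LatticeIsometric L L') :
    ∃ (ψ : L ≃+ L') (φ : {e // ∃ x ∈ L, x e ≠ 0} ≃ {f // ∃ y ∈ L', y f ≠ 0}),
      ∀ x e, Odd ((ψ x : F → ℤ) (φ e)) ↔ Odd ((x : E → ℤ) e) := by
  obtain ⟨ψ, hψ⟩ := h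
  let u : E → L →+ ℤ := fun e => (Pi.evalAddMonoidHom (fun _ => ℤ) e).comp L.subtype
  let v : F → L →+ ℤ := fun f =>
    ((Pi.evalAddMonoidHom (fun _ => ℤ) f).comp L'.subtype).comp ψ.toAddMonoidHom
  have hw : ∀ x : L, (Finset.univ.filter fun e => Odd (u e x)).card =
      (Finset.univ.filter fun f => Odd (v f x)).card := by
    intro x
    refine le_antisymm ?_ (hL.card_odd_le_of_latticeIsometric ψ hψ x)
    have := hL'.card_odd_le_of_latticeIsometric ψ.symm
      (fun a b => by rw [← hψ, ψ.apply_symm_apply, ψ.apply_symm_apply]) (ψ x)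
    rwa [ψ.symm_apply_apply] at this
  obtain ⟨φ, hφ⟩ := exists_equiv_of_card_fiber_eq (fun e => parityChar (u e))
    (fun f => parityChar (v f)) (· ≠ 1) (fun c hc => card_parityChar_eq_of_card_odd_eq u v hw hc)
  have hodd : ∀ (f g : L →+ ℤ), parityChar f = parityChar g ↔ ∀ x, Odd (f x) ↔ Odd (g x) := by
    refine fun f g => ⟨fun h x => ?_, fun h => ?_⟩
    · have := DFunLike.congr_fun h (Multiplicative.ofAdd x)
      rw [parityChar_apply, parityChar_apply] at this
      split_ifs at this with h1 h2 h2 <;> first | exact iff_of_true h1 h2 | exact iff_of_false h1 h2 | omega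
    · refine MonoidHom.ext fun x => ?_
      have h1 := parityChar_apply f x.toAdd
      simp only [h] at h1
      exact h1.trans (parityChar_apply g x.toAdd).symm
  -- Nontrivial parity characters belong to the coordinates that do not vanish identically, since
  -- such a coordinate is odd somewhere.
  have hone : ∀ f : L →+ ℤ, parityChar f ≠ 1 ↔ ∃ x, Odd (f x) := by
    intro f
    have : (1 : Multiplicative L →* ℤ) = parityChar 0 := by ext x; simp [parityChar]
    rw [this, Ne, hodd]
    simp
  have hu : ∀ e, parityChar (u e) ≠ 1 ↔ ∃ x ∈ L, x e ≠ 0 := by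
    intro e
    rw [hone, ← hL.exists_odd_iff]
    simp [u]
  have hv : ∀ f, parityChar (v f) ≠ 1 ↔ ∃ y ∈ L', y f ≠ 0 := by
    intro f
    rw [hone, ← hL'.exists_odd_iff]
    refine ⟨fun ⟨x, hx⟩ => ⟨ψ x, (ψ x).2, hx⟩, fun ⟨y, hy, h⟩ => ⟨ψ.symm ⟨y, hy⟩, ?_⟩⟩
    simpa [v] using h
  refine ⟨ψ, (Equiv.subtypeEquivRight hu).symm.trans (φ.trans (Equiv.subtypeEquivRight hv)),
    fun x e => ?_⟩
  exact (hodd _ _).1 (hφ ((Equiv.subtypeEquivRight hu).symm e)) x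

/-- Isometric regular lattices have the same independent sets, up to a bijection of the coordinates
that do not vanish identically. -/
theorem exists_equiv_supportIndep_iff (hL : L.IsRegularLattice) (hL' : L'.IsRegularLattice)
    (h : LatticeIsometric L L') :
    ∃ φ : {e // ∃ x ∈ L, x e ≠ 0} ≃ {f // ∃ y ∈ L', y f ≠ 0},
      ∀ I : Set {e // ∃ x ∈ L, x e ≠ 0},
        L.SupportIndep (Subtype.val '' I) ↔ L'.SupportIndep (Subtype.val '' (φ '' I)) := by
  obtain ⟨ψ, φ, hφ⟩ := hL.exists_equiv_of_latticeIsometric hL' h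
  refine ⟨φ, fun I => ?_⟩
  rw [hL.supportIndep_iff_odd, hL'.supportIndep_iff_odd]
  have h1 : (∀ x ∈ L, (∀ e ∉ Subtype.val '' I, ¬ Odd (x e)) → ∀ e, ¬ Odd (x e)) ↔
      ∀ x : L, (∀ e ∉ I, ¬ Odd ((x : E → ℤ) e)) →
        ∀ e : {e // ∃ x ∈ L, x e ≠ 0}, ¬ Odd ((x : E → ℤ) e) := by
    exact ⟨fun h x hx => (forall_not_odd_iff x).1
        (h x x.2 ((forall_notMem_image_not_odd_iff I x).2 hx)),
      fun h x hx hI => (forall_not_odd_iff ⟨x, hx⟩).2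
        (h ⟨x, hx⟩ ((forall_notMem_image_not_odd_iff I ⟨x, hx⟩).1 hI))⟩
  have h2 : (∀ y ∈ L', (∀ f ∉ Subtype.val '' (φ '' I), ¬ Odd (y f)) → ∀ f, ¬ Odd (y f)) ↔
      ∀ y : L', (∀ f ∉ φ '' I, ¬ Odd ((y : F → ℤ) f)) →
        ∀ f : {f // ∃ y ∈ L', y f ≠ 0}, ¬ Odd ((y : F → ℤ) f) := by
    exact ⟨fun h y hy => (forall_not_odd_iff y).1
        (h y y.2 ((forall_notMem_image_not_odd_iff _ y).2 hy)),
      fun h y hy hI => (forall_not_odd_iff ⟨y, hy⟩).2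
        (h ⟨y, hy⟩ ((forall_notMem_image_not_odd_iff _ ⟨y, hy⟩).1 hI))⟩
  rw [h1, h2, ← ψ.toEquiv.forall_congr_right]
  refine forall_congr' fun x => ?_
  rw [← φ.forall_congr_right, ← φ.forall_congr_right]
  simp [hφ]

end AddSubgroup.IsRegularLattice

/-! ### Uniqueness of signings -/

namespace Matrix

/-- Every integer combination of the rows is congruent modulo two to a combination with
coefficients and entries `0`, `1` and `-1`. -/
def HasParityRounding {R C : Type*} [Fintype R] (D : Matrix R C ℤ) : Prop :=
  ∀ p : R → ℤ, ∃ q : R → ℤ, (∀ i, (2 : ℤ) ∣ p i - q i) ∧ (∀ i, |q i| ≤ 1) ∧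
    ∀ j, |(q ᵥ* D) j| ≤ 1

namespace HasParityRounding

variable {R C : Type*} [Fintype R] {D D' : Matrix R C ℤ}

/-- Rounding the unit vector at `i` can only change its sign, so the row itself has entries of
absolute value at most 1. -/
theorem mul_self_eq_one (hD : D.HasParityRounding) {i : R} {j : C} (h : D i j ≠ 0) :
    D i j * D i j = 1 := by
  classical
  obtain ⟨q, h1, h2, h3⟩ := hD (Pi.single i 1)
  have hq : ∀ k, k ≠ i → q k = 0 := fun k hk => by
    have h4 := h1 k
    have h5 := h2 k
    rw [Pi.single_eq_of_ne hk] at h4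
    rw [abs_le] at h5
    omega
  have h4 := h3 j
  have h5 := h1 i
  have h6 := h2 i
  rw [vecMul, dotProduct, Finset.sum_eq_single i (fun k _ hk => by rw [hq k hk, zero_mul])
    (by simp), abs_mul] at h4
  rw [Pi.single_eq_same] at h5
  have h7 : |q i| = 1 := by
    rcases abs_cases (q i) with h | h <;> omega
  rw [h7, one_mul] at h4
  rw [abs_le] at h4
  have : D i j = 1 ∨ D i j = -1 := by omega
  rcases this with h | h <;> simp [h]

theorem scale (hD : D.HasParityRounding) {r : R → ℤ} {c : C → ℤ} (hr : ∀ i, r i * r i = 1)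
    (hc : ∀ j, c j * c j = 1) : (of fun i j => r i * D i j * c j).HasParityRounding := by
  have habs : ∀ {s : ℤ}, s * s = 1 → |s| = 1 := fun {s} hs => by
    rcases mul_self_eq_one_iff.1 hs with h | h <;> simp [h]
  intro p
  obtain ⟨q, h1, h2, h3⟩ := hD p
  refine ⟨fun i => r i * q i, fun i => ?_, fun i => ?_, fun j => ?_⟩
  · have := h1 i
    change (2 : ℤ) ∣ p i - r i * q i
    rcases mul_self_eq_one_iff.1 (hr i) with h | h <;> rw [h] <;> omega
  · rw [abs_mul, habs (hr i), one_mul]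
    exact h2 i
  · have : ((fun i => r i * q i) ᵥ* of fun i j => r i * D i j * c j) j = (q ᵥ* D) j * c j := by
      simp only [vecMul, dotProduct, of_apply, Finset.sum_mul]
      refine Finset.sum_congr rfl fun i _ => ?_
      linear_combination (q i * D i j * c j) * hr i
    rw [this, abs_mul, habs (hc j), mul_one]
    exact h3 j

/-- Along a chordless path of rows, the signs of the entries determine the relative sign of the
end rows in a column that meets the path in its end rows only. -/
theorem add_prod_mul_eq_zero (hD : D.HasParityRounding) {n : ℕ} (hn : n ≠ 0) (u : ℕ → R)
    (hu : Set.InjOn u {t | t ≤ n}) (c : ℕ → C) (hc : ∀ t < n, D (u t) (c t) ≠ 0)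
    (hc' : ∀ t < n, D (u (t + 1)) (c t) ≠ 0)
    (hcs : ∀ t < n, ∀ s ≤ n, D (u s) (c t) ≠ 0 → s = t ∨ s = t + 1) {a : C}
    (h0 : D (u 0) a ≠ 0) (hna : D (u n) a ≠ 0) (ha : ∀ t, 0 < t → t < n → D (u t) a = 0) :
    D (u 0) a + (∏ t ∈ Finset.range n, -(D (u t) (c t) * D (u (t + 1)) (c t))) * D (u n) a = 0 := by
  classical
  let T := (Finset.range (n + 1)).image u
  -- Rounding the indicator of the path gives signs on the path and zero elsewhere. In a column
  -- meeting the path in just two rows, the combination is even and at most 1 in absolute value,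
  -- hence zero.
  obtain ⟨q, h1, h2, h3⟩ := hD fun i => if i ∈ T then 1 else 0
  have hq0 : ∀ i ∉ T, q i = 0 := fun i hi => by
    have h4 := h1 i
    have h5 := h2 i
    simp only [hi, if_false] at h4
    rw [abs_le] at h5
    omega
  have hq1 : ∀ t ≤ n, q (u t) = 1 ∨ q (u t) = -1 := fun t ht => by
    have h4 := h1 (u t)
    have h5 := h2 (u t)
    have : u t ∈ T := Finset.mem_image_of_mem u (by simp; omega)
    simp only [this, if_true] at h4
    rw [abs_le] at h5
    omega
  have hsum : ∀ j, (q ᵥ* D) j = ∑ t ∈ Finset.range (n + 1), q (u t) * D (u t) j := by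
    intro j
    have h4 : ∑ i ∈ T, q i * D i j = ∑ t ∈ Finset.range (n + 1), q (u t) * D (u t) j :=
      Finset.sum_image fun s hs t ht h => hu (by simp at hs ⊢; omega) (by simp at ht ⊢; omega) h
    rw [← h4, vecMul, dotProduct]
    exact (Finset.sum_subset (Finset.subset_univ T) fun i _ hi => by rw [hq0 i hi, zero_mul]).symm
  have hpair : ∀ j s t, s < t → t ≤ n → D (u s) j ≠ 0 → D (u t) j ≠ 0 →
      (∀ k ≤ n, D (u k) j ≠ 0 → k = s ∨ k = t) → q (u s) * D (u s) j + q (u t) * D (u t) j = 0 := by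
    intro j s t hst ht hsj htj hj
    have h4 : (q ᵥ* D) j = q (u s) * D (u s) j + q (u t) * D (u t) j := by
      rw [hsum, ← Finset.sum_pair (f := fun k => q (u k) * D (u k) j) hst.ne]
      refine (Finset.sum_subset (fun k hk => ?_) fun k hk hk' => ?_).symm
      · simp only [Finset.mem_insert, Finset.mem_singleton] at hk
        rw [Finset.mem_range]
        omega
      · rw [mul_eq_zero]
        right
        by_contra h
        have := hj k (by simp at hk; omega) h
        exact hk' (by simpa using this)
    have h5 := h3 j
    rw [h4, abs_le] at h5
    have h6 := mul_self_eq_one_iff.1 (hD.mul_self_eq_one hsj)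
    have h7 := mul_self_eq_one_iff.1 (hD.mul_self_eq_one htj)
    rcases hq1 s (by omega) with h | h <;> rcases hq1 t ht with h' | h' <;>
      rcases h6 with h6 | h6 <;> rcases h7 with h7 | h7 <;>
      rw [h, h', h6, h7] at h5 ⊢ <;> omega
  have hprod : ∀ t ≤ n, q (u t) =
      q (u 0) * ∏ t ∈ Finset.range t, -(D (u t) (c t) * D (u (t + 1)) (c t)) := by
    intro t
    induction t with
    | zero => simp
    | succ t ih =>
      intro ht
      rw [Finset.prod_range_succ, ← mul_assoc, ← ih (by omega)]
      have h4 := hpair (c t) t (t + 1) (by omega) ht (hc t ht) (hc' t ht) (hcs t ht)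
      have h5 := hD.mul_self_eq_one (hc' t ht)
      linear_combination D (u (t + 1)) (c t) * h4 - q (u (t + 1)) * h5
  have h4 := hpair a 0 n (by omega) le_rfl h0 hna fun k hk hka => by
    by_contra h
    exact hka (ha k (by omega) (by omega))
  rw [hprod n le_rfl] at h4
  have h5 : q (u 0) ≠ 0 := by
    have := hq1 0 (by omega)
    omega
  refine (mul_eq_zero.1 ?_).resolve_left h5
  linear_combination h4

/-- The graph on the rows in which rows are adjacent if their supports meet in the given columns. -/
def rowGraph (D : Matrix R C ℤ) (S : Set C) : SimpleGraph R where
  Adj i k := i ≠ k ∧ ∃ j ∈ S, D i j ≠ 0 ∧ D k j ≠ 0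
  symm := ⟨fun _ _ ⟨h, j, hj, h1, h2⟩ => ⟨h.symm, j, hj, h2, h1⟩⟩
  loopless := ⟨fun _ h => h.1 rfl⟩

/-- On a shortest path, either an inner row meets column `a` and the path splits there, or
`add_prod_mul_eq_zero` gives both matrices the same relative sign between the ends. -/
theorem mul_eq_mul_of_reachable (hD : D.HasParityRounding) (hD' : D'.HasParityRounding) {S : Set C}
    (hS : ∀ j ∈ S, ∀ i, D i j = D' i j) {a : C} (ha : ∀ i, D i a = 0 ↔ D' i a = 0) {i k : R}
    (hik : (rowGraph D S).Reachable i k) (hi : D i a ≠ 0) (hk : D k a ≠ 0) :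
    D i a * D' i a = D k a * D' k a := by
  classical
  induction hn : (rowGraph D S).dist i k using Nat.strong_induction_on generalizing i k with
  | _ n ih =>
  obtain ⟨p, hp⟩ := hik.exists_walk_length_eq_dist
  have hpn : p.length = n := hp.trans hn
  rcases Nat.eq_zero_or_pos n with h0 | h0
  · rw [hik.dist_eq_zero_iff.1 (hn.trans h0)]
  by_cases hmid : ∃ t, 0 < t ∧ t < n ∧ D (p.getVert t) a ≠ 0
  · obtain ⟨t, ht0, htn, hta⟩ := hmid
    have h1 := SimpleGraph.dist_le (p.take t)
    have h2 := SimpleGraph.dist_le (p.drop t)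
    rw [SimpleGraph.Walk.take_length] at h1
    rw [SimpleGraph.Walk.drop_length] at h2
    rw [ih _ (by omega) (p.take t).reachable hi hta rfl,
      ih _ (by omega) (p.drop t).reachable hta hk rfl]
  push Not at hmid
  -- Rows sharing a column of `S` are at distance at most 1, so a shortest path has no shortcut
  -- between them.
  have hshort : ∀ s t, s ≤ n → t ≤ n → ∀ j ∈ S, D (p.getVert s) j ≠ 0 → D (p.getVert t) j ≠ 0 →
      t ≤ s + 1 := by
    intro s t hs ht j hj hsj htj
    have hw : ∃ w : (rowGraph D S).Walk (p.getVert s) (p.getVert t), w.length ≤ 1 := by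
      by_cases h : p.getVert s = p.getVert t
      · rw [← h]
        exact ⟨SimpleGraph.Walk.nil, Nat.zero_le 1⟩
      · exact ⟨SimpleGraph.Walk.cons ⟨h, j, hj, hsj, htj⟩ SimpleGraph.Walk.nil, le_rfl⟩
    obtain ⟨w, hw⟩ := hw
    have h1 := SimpleGraph.dist_le ((p.take s).append (w.append (p.drop t)))
    rw [SimpleGraph.Walk.length_append, SimpleGraph.Walk.length_append,
      SimpleGraph.Walk.take_length, SimpleGraph.Walk.drop_length] at h1
    omega
  have hadj : ∀ t, ∃ j, t < n → j ∈ S ∧ D (p.getVert t) j ≠ 0 ∧ D (p.getVert (t + 1)) j ≠ 0 := by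
    intro t
    by_cases ht : t < n
    · obtain ⟨-, j, hj⟩ := p.adj_getVert_succ (i := t) (by omega)
      exact ⟨j, fun _ => hj⟩
    · exact ⟨a, fun h => absurd h ht⟩
  choose c hc using hadj
  have hinj : Set.InjOn p.getVert {t | t ≤ n} := by
    have := (p.isPath_of_length_eq_dist hp).getVert_injOn
    rwa [hpn] at this
  have hcs : ∀ t < n, ∀ s ≤ n, D (p.getVert s) (c t) ≠ 0 → s = t ∨ s = t + 1 := by
    intro t ht s hs hst
    obtain ⟨h1, h2, h3⟩ := hc t ht
    have h4 := hshort t s (by omega) hs (c t) h1 h2 hst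
    have h5 := hshort s (t + 1) hs (by omega) (c t) h1 hst h3
    omega
  have hpn' : p.getVert n = k := by rw [← hpn, p.getVert_length]
  have key := hD.add_prod_mul_eq_zero h0.ne' p.getVert hinj c (fun t ht => (hc t ht).2.1)
    (fun t ht => (hc t ht).2.2) hcs (a := a) (by simpa using hi) (by rwa [hpn']) hmid
  have key' := hD'.add_prod_mul_eq_zero h0.ne' p.getVert hinj c
    (fun t ht => by rw [← hS _ (hc t ht).1]; exact (hc t ht).2.1)
    (fun t ht => by rw [← hS _ (hc t ht).1]; exact (hc t ht).2.2)
    (fun t ht s hs => by rw [← hS _ (hc t ht).1]; exact hcs t ht s hs)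
    (a := a) (by simpa using (ha i).not.1 hi) (by rw [hpn']; exact (ha k).not.1 hk)
    (fun t h1 h2 => (ha _).1 (hmid t h1 h2))
  have hprod : ∏ t ∈ Finset.range n, -(D' (p.getVert t) (c t) * D' (p.getVert (t + 1)) (c t)) =
      ∏ t ∈ Finset.range n, -(D (p.getVert t) (c t) * D (p.getVert (t + 1)) (c t)) := by
    refine Finset.prod_congr rfl fun t ht => ?_
    have := (hc t (Finset.mem_range.1 ht)).1
    rw [hS _ this, hS _ this]
  have hsq : ∀ m ≤ n, (∏ t ∈ Finset.range m, -(D (p.getVert t) (c t) * D (p.getVert (t + 1)) (c t))) *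
      (∏ t ∈ Finset.range m, -(D (p.getVert t) (c t) * D (p.getVert (t + 1)) (c t))) = 1 := by
    intro m hm
    rw [← Finset.prod_mul_distrib]
    refine Finset.prod_eq_one fun t ht => ?_
    have ht := hc t (by simp at ht; omega)
    linear_combination (D (p.getVert (t + 1)) (c t) * D (p.getVert (t + 1)) (c t)) *
      hD.mul_self_eq_one ht.2.1 + hD.mul_self_eq_one ht.2.2
  rw [hprod] at key'
  have hsq := hsq n le_rfl
  simp only [SimpleGraph.Walk.getVert_zero, hpn'] at key key'
  generalize (∏ t ∈ Finset.range n, -(D (p.getVert t) (c t) * D (p.getVert (t + 1)) (c t))) = P at *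
  rw [eq_neg_of_add_eq_zero_left key, eq_neg_of_add_eq_zero_left key']
  linear_combination (D k a * D' k a) * hsq

/-- Signings with parity rounding that agree on some columns can be made to agree on one more. -/
theorem exists_scaling_insert (hD : D.HasParityRounding) (hD' : D'.HasParityRounding) {S : Set C}
    (hS : ∀ j ∈ S, ∀ i, D i j = D' i j) {a : C} (haS : a ∉ S) (ha : ∀ i, D i a = 0 ↔ D' i a = 0) :
    ∃ (r : R → ℤ) (c : C → ℤ), (∀ i, r i * r i = 1) ∧ (∀ j, c j * c j = 1) ∧
      ∀ j ∈ insert a S, ∀ i, D' i j = r i * D i j * c j := by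
  classical
  -- Row signs are constant on components, chosen to correct column `a`. A column of `S` meets only
  -- one component, whose sign it takes as well, so that its entries are unchanged.
  let G := rowGraph D S
  have hex : ∀ x : G.ConnectedComponent, ∃ s : ℤ, s * s = 1 ∧
      ∀ i, G.connectedComponentMk i = x → D i a ≠ 0 → s = D i a * D' i a := by
    intro x
    by_cases h : ∃ k, G.connectedComponentMk k = x ∧ D k a ≠ 0
    · obtain ⟨k, hk, hka⟩ := h
      refine ⟨D k a * D' k a, ?_, fun i hi hia => ?_⟩
      · linear_combination (D' k a * D' k a) * hD.mul_self_eq_one hka +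
          hD'.mul_self_eq_one ((ha k).not.1 hka)
      · exact hD.mul_eq_mul_of_reachable hD' hS ha
          (SimpleGraph.ConnectedComponent.exact (hk.trans hi.symm)) hka hia
    · push Not at h
      exact ⟨1, rfl, fun i hi hia => absurd (h i hi) hia⟩
  choose f hf hfa using hex
  have hcol : ∀ j, ∃ s : ℤ, s * s = 1 ∧ (j = a → s = 1) ∧
      (j ∈ S → ∀ i, D i j ≠ 0 → s = f (G.connectedComponentMk i)) := by
    intro j
    by_cases h : j ∈ S ∧ ∃ k, D k j ≠ 0
    · obtain ⟨hj, k, hk⟩ := h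
      refine ⟨f (G.connectedComponentMk k), hf _, fun h => absurd (h ▸ hj) haS, fun _ i hi => ?_⟩
      by_cases hik : i = k
      · rw [hik]
      · have : G.Adj k i := ⟨Ne.symm hik, j, hj, hk, hi⟩
        rw [SimpleGraph.ConnectedComponent.sound this.reachable]
    · push Not at h
      exact ⟨1, rfl, fun _ => rfl, fun hj i hi => absurd (h hj i) hi⟩
  choose c hc hca hcS using hcol
  refine ⟨fun i => f (G.connectedComponentMk i), c, fun i => hf _, hc, fun j hj i => ?_⟩
  rcases hj with rfl | hj
  · rw [hca j rfl, mul_one]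
    change D' i j = f (G.connectedComponentMk i) * D i j
    by_cases h : D i j = 0
    · rw [h, (ha i).1 h, mul_zero]
    · rw [hfa _ i rfl h]
      linear_combination (-D' i j) * hD.mul_self_eq_one h
  · rw [← hS j hj]
    by_cases h : D i j = 0
    · simp [h]
    · rw [hcS j hj i h]
      linear_combination (-D i j) * hf (G.connectedComponentMk i)

/-- Camion's theorem: a signing with parity rounding is determined by its support up to changing
the signs of rows and columns. -/
theorem exists_scaling [Fintype C] (hD : D.HasParityRounding) (hD' : D'.HasParityRounding)
    (h : ∀ i j, D i j = 0 ↔ D' i j = 0) :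
    ∃ (r : R → ℤ) (c : C → ℤ), (∀ i, r i * r i = 1) ∧ (∀ j, c j * c j = 1) ∧
      ∀ i j, D' i j = r i * D i j * c j := by
  classical
  have key : ∀ S : Finset C, ∃ (r : R → ℤ) (c : C → ℤ), (∀ i, r i * r i = 1) ∧
      (∀ j, c j * c j = 1) ∧ ∀ j ∈ S, ∀ i, D' i j = r i * D i j * c j := by
    intro S
    induction S using Finset.induction_on with
    | empty => exact ⟨fun _ => 1, fun _ => 1, by simp, by simp, by simp⟩
    | insert a S ha ih =>
      obtain ⟨r, c, hr, hc, hS⟩ := ih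
      have hr0 : ∀ i, r i ≠ 0 := fun i h0 => by simpa [h0] using hr i
      have hc0 : ∀ j, c j ≠ 0 := fun j h0 => by simpa [h0] using hc j
      obtain ⟨r', c', hr', hc', hS'⟩ := (hD.scale hr hc).exists_scaling_insert hD'
        (S := (S : Set C)) (fun j hj i => (hS j hj i).symm) (a := a) (by simpa using ha)
        (fun i => by simp [hr0, hc0, h])
      refine ⟨fun i => r' i * r i, fun j => c' j * c j, fun i => ?_, fun j => ?_, fun j hj i => ?_⟩
      · linear_combination (r i * r i) * hr' i + hr i
      · linear_combination (c j * c j) * hc' j + hc j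
      · rw [hS' j (by simpa using hj)]
        simp only [of_apply]
        ring
  obtain ⟨r, c, hr, hc, hS⟩ := key Finset.univ
  exact ⟨r, c, hr, hc, fun i j => hS j (Finset.mem_univ j) i⟩

end HasParityRounding

end Matrix

/-! ### Reconstruction of a regular lattice from its independent sets -/

namespace AddSubgroup

/-- Lattice vectors that restrict to the unit vectors outside `B`. -/
structure IsFundamentalFamily {E : Type*} (L : AddSubgroup (E → ℤ)) (B : Set E)
    (v : {e // e ∉ B} → E → ℤ) : Prop where
  mem : ∀ i, v i ∈ L
  apply_self : ∀ i, v i i = 1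
  apply_of_ne : ∀ (i : {e // e ∉ B}) (e : E), e ∉ B → e ≠ i → v i e = 0

variable {E : Type*} {L L' : AddSubgroup (E → ℤ)} {B : Set E}

theorem SupportIndep.subset {I J : Set E} (h : L.SupportIndep J) (hIJ : I ⊆ J) :
    L.SupportIndep I :=
  fun x hx hI => h x hx fun e he => hI e fun h => he (hIJ h)

theorem exists_maximal_supportIndep [Finite E] (L : AddSubgroup (E → ℤ)) :
    ∃ B, Maximal L.SupportIndep B := by
  have : (Set.ofPred L.SupportIndep).Nonempty := ⟨∅, fun x _ h => funext fun e => h e (by simp)⟩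
  exact (Set.toFinite (Set.ofPred L.SupportIndep)).exists_maximal this

/-- By maximality, `B` with `i` added supports a nonzero vector, necessarily nonzero at `i`.
`exists_odd` and reduction turn that coordinate into a sign. -/
theorem IsRegularLattice.exists_isFundamentalFamily (hL : L.IsRegularLattice)
    (hB : Maximal L.SupportIndep B) : ∃ v, L.IsFundamentalFamily B v := by
  have key : ∀ i : {e // e ∉ B}, ∃ v ∈ L, v i = 1 ∧ ∀ e, e ∉ B → e ≠ i → v e = 0 := by
    intro i
    have h1 : ¬ L.SupportIndep (insert (i : E) B) := fun h =>
      i.2 (hB.le_of_ge h (Set.subset_insert _ _) (Set.mem_insert _ _))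
    simp only [SupportIndep, not_forall] at h1
    obtain ⟨x, hx, hxB, hx0⟩ := h1
    have hxi : x i ≠ 0 := by
      intro h
      refine hx0 (hB.prop x hx fun e he => ?_)
      by_cases hei : e = i
      · rw [hei, h]
      · exact hxB e (by simp [hei, he])
    obtain ⟨z, hz, hz0, hzi⟩ := hL.exists_odd hx hxi
    obtain ⟨y, hy, hy1, -, hy0⟩ := hL.exists_reduced hz
    have hyi := (hy0 i).2 hzi
    refine ⟨y i • y, L.zsmul_mem hy _, ?_, fun e he hei => ?_⟩
    · have := hy1 i
      rw [abs_le] at this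
      have : y i = 1 ∨ y i = -1 := by omega
      rcases this with h | h <;> simp [h]
    · have h2 := hz0 e (hxB e (by simp [hei, he]))
      have : y e = 0 := by
        by_contra h
        have := (hy0 e).1 h
        rw [h2] at this
        simp at this
      simp [this]
  choose v hv using key
  exact ⟨v, fun i => (hv i).1, fun i => (hv i).2.1, fun i => (hv i).2.2⟩

namespace IsFundamentalFamily

variable {v v' : {e // e ∉ B} → E → ℤ}

theorem sum_smul_apply [Fintype {e // e ∉ B}] (hv : L.IsFundamentalFamily B v)
    (p : {e // e ∉ B} → ℤ) (i : {e // e ∉ B}) : (∑ k, p k • v k) i = p i := by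
  classical
  rw [Finset.sum_apply, Finset.sum_eq_single i]
  · simp [hv.apply_self]
  · intro k _ hk
    simp [hv.apply_of_ne k i i.2 fun h => hk (Subtype.ext h.symm)]
  · simp

theorem eq_sum_smul [Fintype {e // e ∉ B}] (hv : L.IsFundamentalFamily B v)
    (hB : L.SupportIndep B) {x : E → ℤ} (hx : x ∈ L) : x = ∑ i : {e // e ∉ B}, x i • v i := by
  rw [← sub_eq_zero]
  refine hB _ (L.sub_mem hx (L.sum_mem fun i _ => L.zsmul_mem (hv.mem i) _)) fun e he => ?_
  have := hv.sum_smul_apply (fun i => x i) ⟨e, he⟩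
  simp only at this
  rw [Pi.sub_apply, this, sub_self]

/-- The matrix of a fundamental family, with rows outside and columns inside `B`. -/
def matrix (v : {e // e ∉ B} → E → ℤ) : Matrix {e // e ∉ B} {e // e ∈ B} ℤ :=
  Matrix.of fun i b => v i b

theorem vecMul_matrix_apply [Fintype {e // e ∉ B}] (p : {e // e ∉ B} → ℤ) (b : {e // e ∈ B}) :
    (p ᵥ* matrix v) b = (∑ i, p i • v i) b := by
  simp [Matrix.vecMul, dotProduct, matrix, Finset.sum_apply]

/-- The coefficients of a lattice vector in the family are its coordinates outside `B`, so reducing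
the vector bounds coefficients and entries together. -/
theorem hasParityRounding_matrix [Fintype {e // e ∉ B}] (hv : L.IsFundamentalFamily B v)
    (hL : L.IsRegularLattice) (hB : L.SupportIndep B) : (matrix v).HasParityRounding := by
  intro p
  obtain ⟨y, hy, h1, h2⟩ := hL.exists_abs_le_one (∑ i, p i • v i)
    (L.sum_mem fun i _ => L.zsmul_mem (hv.mem i) _)
  refine ⟨fun i => y i, fun i => ?_, fun i => h1 i, fun b => ?_⟩
  · have := h2 i
    rwa [hv.sum_smul_apply] at this
  · rw [vecMul_matrix_apply, ← hv.eq_sum_smul hB hy]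
    exact h1 b

/-- Only multiples of `v i` are supported on `B` with `i` added. Thus basis exchanges determine the
zero pattern of the matrix. -/
theorem matrix_apply_ne_zero_iff [Finite E] (hv : L.IsFundamentalFamily B v)
    (hB : L.SupportIndep B) (i : {e // e ∉ B}) (b : {e // e ∈ B}) :
    matrix v i b ≠ 0 ↔ L.SupportIndep (insert (i : E) (B \ {(b : E)})) := by
  refine ⟨fun h x hx hI => ?_, fun h h0 => ?_⟩
  · have h1 : x = x i • v i := by
      rw [← sub_eq_zero]
      refine hB _ (L.sub_mem hx (L.zsmul_mem (hv.mem i) _)) fun e he => ?_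
      by_cases hei : e = i
      · subst hei
        simp [hv.apply_self]
      · simp [hv.apply_of_ne i e he hei, hI e (by simp [hei, he])]
    have h2 : x b = 0 := hI b (by
      have : (b : E) ≠ i := fun h => i.2 (h ▸ b.2)
      simp [this])
    rw [h1] at h2
    have h3 : x i = 0 := (mul_eq_zero.1 h2).resolve_right h
    rw [h1, h3, zero_smul]
  · have h1 := h (v i) (hv.mem i) fun e he => by
      by_cases heb : e = b
      · rw [heb]; exact h0
      · simp only [Set.mem_insert_iff, Set.mem_sdiff, Set.mem_singleton_iff, heb, not_false_eq_true,
          and_true, not_or] at he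
        exact hv.apply_of_ne i e he.2 he.1
    have h2 := hv.apply_self i
    rw [h1] at h2
    simp at h2

theorem mul_mem_of_scaling [Fintype {e // e ∉ B}] (hv : L.IsFundamentalFamily B v)
    (hv' : L'.IsFundamentalFamily B v') (hB : L.SupportIndep B) {ε : E → ℤ}
    (hε : ∀ e, ε e * ε e = 1) (h : ∀ i b, matrix v' i b = ε i * matrix v i b * ε b)
    {x : E → ℤ} (hx : x ∈ L) : ε * x ∈ L' := by
  have : ε * x = ∑ i : {e // e ∉ B}, (ε i * x i) • v' i := by
    ext e
    by_cases he : e ∈ B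
    · have h1 := congrFun (hv.eq_sum_smul hB hx) e
      rw [Pi.mul_apply, h1, Finset.sum_apply, Finset.sum_apply, Finset.mul_sum]
      refine Finset.sum_congr rfl fun i _ => ?_
      have h2 : v' i e = ε i * v i e * ε e := h i ⟨e, he⟩
      rw [Pi.smul_apply, Pi.smul_apply, h2, smul_eq_mul, smul_eq_mul]
      linear_combination (-ε e * x i * v i e) * hε i
    · exact (hv'.sum_smul_apply (fun i => ε i * x i) ⟨e, he⟩).symm
  rw [this]
  exact L'.sum_mem fun i _ => L'.zsmul_mem (hv'.mem i) _

end IsFundamentalFamily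

namespace IsRegularLattice

/-- Regular lattices with the same independent sets agree up to changing the signs of
coordinates. -/
theorem exists_sign_mul_mem_iff [Fintype E] (hL : L.IsRegularLattice) (hL' : L'.IsRegularLattice)
    (h : ∀ I, L.SupportIndep I ↔ L'.SupportIndep I) :
    ∃ ε : E → ℤ, (∀ e, ε e * ε e = 1) ∧ ∀ x, x ∈ L ↔ ε * x ∈ L' := by
  classical
  obtain ⟨B, hB⟩ := L.exists_maximal_supportIndep
  have hB' : Maximal L'.SupportIndep B := by
    rwa [← (funext fun I => propext (h I) : L.SupportIndep = L'.SupportIndep)]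
  obtain ⟨v, hv⟩ := hL.exists_isFundamentalFamily hB
  obtain ⟨v', hv'⟩ := hL'.exists_isFundamentalFamily hB'
  obtain ⟨r, c, hr, hc, hrc⟩ := (hv.hasParityRounding_matrix hL hB.prop).exists_scaling
    (hv'.hasParityRounding_matrix hL' hB'.prop) fun i b => by
      rw [← not_iff_not]
      exact (hv.matrix_apply_ne_zero_iff hB.prop i b).trans
        ((h _).trans (hv'.matrix_apply_ne_zero_iff hB'.prop i b).symm)
  let ε : E → ℤ := fun e => if he : e ∈ B then c ⟨e, he⟩ else r ⟨e, he⟩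
  have hε : ∀ e, ε e * ε e = 1 := fun e => by
    simp only [ε]
    split_ifs with he
    · exact hc _
    · exact hr _
  have hεr : ∀ i : {e // e ∉ B}, ε i = r i := fun i => dif_neg i.2
  have hεc : ∀ b : {e // e ∈ B}, ε b = c b := fun b => dif_pos b.2
  refine ⟨ε, hε, fun x => ⟨fun hx => ?_, fun hx => ?_⟩⟩
  · exact hv.mul_mem_of_scaling hv' hB.prop hε (fun i b => by rw [hεr, hεc, hrc]) hx
  · have h1 := hv'.mul_mem_of_scaling hv hB'.prop hε (fun i b => by
      rw [hrc, ← hεr, ← hεc]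
      linear_combination (-IsFundamentalFamily.matrix v i b) * (ε b * ε b * hε i + hε b)) hx
    have h2 : ε * (ε * x) = x := by
      ext e
      simp [← mul_assoc, hε e]
    rwa [h2] at h1

theorem latticeIsometric_of_supportIndep_iff [Fintype E] (hL : L.IsRegularLattice)
    (hL' : L'.IsRegularLattice) (h : ∀ I, L.SupportIndep I ↔ L'.SupportIndep I) :
    LatticeIsometric L L' := by
  obtain ⟨ε, hε, hmem⟩ := hL.exists_sign_mul_mem_iff hL' h
  have h2 : ∀ x, ε * (ε * x) = x := fun x => by
    ext e
    simp [← mul_assoc, hε e]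
  refine ⟨⟨⟨fun x => ⟨ε * x, (hmem x).1 x.2⟩, fun y => ⟨ε * y, (hmem _).2 (by rw [h2]; exact y.2)⟩,
    fun x => Subtype.ext (h2 x), fun y => Subtype.ext (h2 y)⟩,
    fun x y => Subtype.ext (mul_add ε (x : E → ℤ) y)⟩, fun x y => ?_⟩
  refine Finset.sum_congr rfl fun e _ => ?_
  change ε e * (x : E → ℤ) e * (ε e * (y : E → ℤ) e) = _
  linear_combination ((x : E → ℤ) e * (y : E → ℤ) e) * hε e

end IsRegularLattice

end AddSubgroup

/-! ### Composition of isometries and change of coordinates -/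

theorem LatticeIsometric.symm {E F : Type*} [Fintype E] [Fintype F] {L : AddSubgroup (E → ℤ)}
    {L' : AddSubgroup (F → ℤ)} (h : LatticeIsometric L L') : LatticeIsometric L' L := by
  obtain ⟨ψ, hψ⟩ := h
  exact ⟨ψ.symm, fun x y => by rw [← hψ, ψ.apply_symm_apply, ψ.apply_symm_apply]⟩

theorem LatticeIsometric.trans {E F G : Type*} [Fintype E] [Fintype F] [Fintype G]
    {L : AddSubgroup (E → ℤ)} {L' : AddSubgroup (F → ℤ)} {L'' : AddSubgroup (G → ℤ)}
    (h : LatticeIsometric L L') (h' : LatticeIsometric L' L'') : LatticeIsometric L L'' := by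
  obtain ⟨ψ, hψ⟩ := h
  obtain ⟨ψ', hψ'⟩ := h'
  exact ⟨ψ.trans ψ', fun x y => by
    rw [AddEquiv.trans_apply, AddEquiv.trans_apply, hψ', hψ]⟩

namespace AddSubgroup

/-- The lattice of the restrictions of the vectors along a map of the coordinates. -/
def pullback {E X : Type*} (L : AddSubgroup (E → ℤ)) (a : X → E) : AddSubgroup (X → ℤ) :=
  L.map (LinearMap.funLeft ℤ ℤ a).toAddMonoidHom

variable {E F X : Type*} {L : AddSubgroup (E → ℤ)} {L' : AddSubgroup (F → ℤ)} {a : X → E}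
  {b : X → F}

theorem mem_pullback {y : X → ℤ} : y ∈ L.pullback a ↔ ∃ x ∈ L, x ∘ a = y := Iff.rfl

theorem supportIndep_pullback_iff (ha : a.Injective) (h0 : ∀ x ∈ L, ∀ e ∉ Set.range a, x e = 0)
    (I : Set X) : (L.pullback a).SupportIndep I ↔ L.SupportIndep (a '' I) := by
  refine ⟨fun h x hx hI => ?_, fun h y hy hI => ?_⟩
  · have h1 := h (x ∘ a) (mem_pullback.2 ⟨x, hx, rfl⟩) fun i hi =>
      hI (a i) fun ⟨k, hk, hki⟩ => hi (ha hki ▸ hk)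
    ext e
    by_cases he : e ∈ Set.range a
    · obtain ⟨i, rfl⟩ := he
      exact congrFun h1 i
    · exact h0 x hx e he
  · obtain ⟨x, hx, rfl⟩ := mem_pullback.1 hy
    have h1 := h x hx fun e he => by
      by_cases hr : e ∈ Set.range a
      · obtain ⟨i, rfl⟩ := hr
        exact hI i fun hi => he ⟨i, hi, rfl⟩
      · exact h0 x hx e hr
    rw [h1]
    rfl

theorem IsRegularLattice.pullback (hL : L.IsRegularLattice)
    (h0 : ∀ x ∈ L, ∀ e ∉ Set.range a, x e = 0) : (L.pullback a).IsRegularLattice where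
  mem_of_two_nsmul_mem y hy := by
    obtain ⟨x, hx, hxy⟩ := mem_pullback.1 hy
    obtain ⟨z, hz, hxz⟩ := hL.exists_two_nsmul hx fun e => by
      by_cases he : e ∈ Set.range a
      · obtain ⟨i, rfl⟩ := he
        exact ⟨y i, by simpa using congrFun hxy i⟩
      · simp [h0 x hx e he]
    refine mem_pullback.2 ⟨z, hz, ?_⟩
    ext i
    have := congrFun hxy i
    rw [hxz] at this
    simpa using this
  exists_abs_le_one y hy := by
    obtain ⟨x, hx, rfl⟩ := mem_pullback.1 hy
    obtain ⟨z, hz, h1, h2⟩ := hL.exists_abs_le_one x hx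
    exact ⟨z ∘ a, mem_pullback.2 ⟨z, hz, rfl⟩, fun i => h1 (a i), fun i => h2 (a i)⟩

variable [Fintype E] [Fintype F] [Fintype X]

theorem latticeIsometric_pullback (ha : a.Injective)
    (h0 : ∀ x ∈ L, ∀ e ∉ Set.range a, x e = 0) : LatticeIsometric L (L.pullback a) := by
  let ψ : L →+ L.pullback a :=
    { toFun x := ⟨x ∘ a, mem_pullback.2 ⟨x, x.2, rfl⟩⟩
      map_zero' := rfl
      map_add' _ _ := rfl }
  have hψ : Function.Bijective ψ := by
    refine ⟨(injective_iff_map_eq_zero ψ).2 fun x hx => ?_, fun y => ?_⟩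
    · ext e
      by_cases he : e ∈ Set.range a
      · obtain ⟨i, rfl⟩ := he
        exact congrFun (congrArg Subtype.val hx) i
      · exact h0 x x.2 e he
    · obtain ⟨x, hx, hxy⟩ := mem_pullback.1 y.2
      exact ⟨⟨x, hx⟩, Subtype.ext hxy⟩
  refine ⟨AddEquiv.ofBijective ψ hψ, fun x y => ?_⟩
  exact Fintype.sum_of_injective a ha _ _ (fun e he => by rw [h0 x x.2 e he, zero_mul])
    fun i => rfl

/-- Restricting to `X` discards only zero coordinates, so both lattices can be compared on one index
type. -/
theorem IsRegularLattice.latticeIsometric_of_image (hL : L.IsRegularLattice)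
    (hL' : L'.IsRegularLattice) (ha : a.Injective) (hb : b.Injective)
    (ha0 : ∀ x ∈ L, ∀ e ∉ Set.range a, x e = 0) (hb0 : ∀ x ∈ L', ∀ f ∉ Set.range b, x f = 0)
    (h : ∀ I : Set X, L.SupportIndep (a '' I) ↔ L'.SupportIndep (b '' I)) :
    LatticeIsometric L L' := by
  refine (latticeIsometric_pullback ha ha0).trans (LatticeIsometric.trans ?_
    (latticeIsometric_pullback hb hb0).symm)
  refine (hL.pullback ha0).latticeIsometric_of_supportIndep_iff (hL'.pullback hb0) fun I => ?_
  rw [supportIndep_pullback_iff ha ha0, supportIndep_pullback_iff hb hb0, h]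

end AddSubgroup

/-! ### Matroids and their lattices -/

namespace Matroid

/-- The independent sets of the matroid are the sets of coordinates that support no nonzero vector
of the lattice. -/
def IsSupportMatroid {α : Type*} (M : Matroid α) (L : AddSubgroup (M.E → ℤ)) : Prop :=
  ∀ I : Set M.E, M.Indep (Subtype.val '' I) ↔ L.SupportIndep I

theorem contractColoops_indep_iff {α : Type*} (M : Matroid α) (I : Set M.contractColoops.E) :
    M.contractColoops.Indep (Subtype.val '' I) ↔ M.Indep (Subtype.val '' I) := by
  have : M.contractColoops = M.delete M.coloops :=
    contract_eq_delete_of_subset_coloops subset_rfl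
  simp only [this, delete_indep_iff, and_iff_left_iff_imp]
  intro _
  rw [Set.disjoint_left]
  rintro _ ⟨e, -, rfl⟩
  exact e.2.2

theorem dual_deleteLoops {α : Type*} (M : Matroid α) :
    M.deleteLoops.dual = M.dual.contractColoops := by
  rw [deleteLoops, contractColoops, dual_delete, dual_coloops]

/-- A nonzero entry `v i e` at a co-loop would allow exchanging `e` for `i` and then adding `e`
back, enlarging `B`. Conversely, a circuit through `e` supports a lattice vector that cannot vanish
at `e`. -/
theorem IsSupportMatroid.mem_coloops_iff {α : Type*} {M : Matroid α} [Fintype M.E]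
    {L : AddSubgroup (M.E → ℤ)} (h : M.IsSupportMatroid L) (hL : L.IsRegularLattice) (e : M.E) :
    (e : α) ∈ M.coloops ↔ ∀ x ∈ L, x e = 0 := by
  classical
  refine ⟨fun he x hx => ?_, fun he => ?_⟩
  · obtain ⟨B, hB⟩ := L.exists_maximal_supportIndep
    obtain ⟨v, hv⟩ := hL.exists_isFundamentalFamily hB
    have hins : ∀ J, L.SupportIndep J → L.SupportIndep (insert e J) := fun J hJ => by
      rw [← h, Set.image_insert_eq, ← Set.union_singleton,
        union_indep_iff_indep_of_subset_coloops (Set.singleton_subset_iff.2 he), h]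
      exact hJ
    have heB : e ∈ B := hB.le_of_ge (hins B hB.prop) (Set.subset_insert _ _) (Set.mem_insert _ _)
    have hve : ∀ i, v i e = 0 := by
      intro i
      by_contra hne
      have h1 := hins _ ((hv.matrix_apply_ne_zero_iff hB.prop i ⟨e, heB⟩).1 hne)
      have h2 : insert (i : M.E) B ⊆ insert e (insert (i : M.E) (B \ {e})) := by
        intro k hk
        simp only [Set.mem_insert_iff, Set.mem_sdiff, Set.mem_singleton_iff] at hk ⊢
        tauto
      exact i.2 (hB.le_of_ge (h1.subset h2) (Set.subset_insert _ _) (Set.mem_insert _ _))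
    rw [hv.eq_sum_smul hB.prop hx]
    simp [Finset.sum_apply, hve]
  · by_contra hne
    obtain ⟨C, hC, heC⟩ := exists_mem_isCircuit_of_not_isColoop e.2 hne
    have himg : ∀ D ⊆ M.E, Subtype.val '' (Subtype.val ⁻¹' D : Set M.E) = D := fun D hD => by
      rw [Subtype.image_preimage_coe, Set.inter_eq_right.2 hD]
    have h1 := hC.not_indep
    rw [← himg C hC.subset_ground, h] at h1
    have h2 := hC.sdiff_singleton_indep heC
    rw [← himg _ (Set.sdiff_subset.trans hC.subset_ground), h] at h2
    refine h1 fun x hx hxC => h2 x hx fun k hk => ?_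
    by_cases hke : k = e
    · rw [hke, he x hx]
    · refine hxC k fun hkC => hk ⟨hkC, fun h3 => hke (Subtype.ext h3)⟩

/-- The ground set without the co-loops consists of the coordinates that do not vanish
identically. -/
theorem IsSupportMatroid.exists_equiv_contractColoops {α : Type*} {M : Matroid α} [Fintype M.E]
    {L : AddSubgroup (M.E → ℤ)} (h : M.IsSupportMatroid L) (hL : L.IsRegularLattice) :
    ∃ ι : M.contractColoops.E ≃ {e // ∃ x ∈ L, x e ≠ 0}, ∀ I : Set M.contractColoops.E,
      M.contractColoops.Indep (Subtype.val '' I) ↔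
        L.SupportIndep (Subtype.val '' (ι '' I)) := by
  have hmem : ∀ e : M.E, (e : α) ∉ M.coloops ↔ ∃ x ∈ L, x e ≠ 0 := fun e => by
    rw [h.mem_coloops_iff hL]
    push Not
    rfl
  let ι : M.contractColoops.E ≃ {e // ∃ x ∈ L, x e ≠ 0} :=
    { toFun e := ⟨⟨e, e.2.1⟩, (hmem ⟨e, e.2.1⟩).1 e.2.2⟩
      invFun e := ⟨e, e.1.2, (hmem e).2 e.2⟩
      left_inv _ := rfl
      right_inv _ := rfl }
  refine ⟨ι, fun I => ?_⟩
  rw [contractColoops_indep_iff, ← h, Set.image_image, Set.image_image]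
  rfl

/-- The lattices of two matroids are isometric if and only if the matroids without co-loops are
isomorphic. -/
theorem IsSupportMatroid.latticeIsometric_iff {α β : Type*} {M : Matroid α} {N : Matroid β}
    [Fintype M.E] [Fintype N.E] {L : AddSubgroup (M.E → ℤ)} {L' : AddSubgroup (N.E → ℤ)}
    (hM : M.IsSupportMatroid L) (hN : N.IsSupportMatroid L') (hL : L.IsRegularLattice)
    (hL' : L'.IsRegularLattice) :
    LatticeIsometric L L' ↔ M.contractColoops.IsIsomorphic N.contractColoops := by
  classical
  obtain ⟨ι, hι⟩ := hM.exists_equiv_contractColoops hL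
  obtain ⟨κ, hκ⟩ := hN.exists_equiv_contractColoops hL'
  refine ⟨fun h => ?_, fun ⟨φ, hφ⟩ => ?_⟩
  · obtain ⟨φ, hφ⟩ := hL.exists_equiv_supportIndep_iff hL' h
    refine ⟨ι.trans (φ.trans κ.symm), fun I => ?_⟩
    rw [hι, hκ, hφ]
    simp only [Set.image_image, Equiv.trans_apply, Equiv.apply_symm_apply]
  · have : Fintype M.contractColoops.E := Fintype.ofEquiv _ ι.symm
    refine hL.latticeIsometric_of_image hL' (a := fun e => (ι e : M.E))
      (b := fun e => (κ (φ e) : N.E)) (Subtype.val_injective.comp ι.injective)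
      (Subtype.val_injective.comp (κ.injective.comp φ.injective)) (fun x hx e he => ?_)
      (fun x hx f hf => ?_) fun I => ?_
    · by_contra hne
      exact he ⟨ι.symm ⟨e, x, hx, hne⟩, by simp⟩
    · by_contra hne
      exact hf ⟨φ.symm (κ.symm ⟨f, x, hx, hne⟩), by simp⟩
    · have := hφ I
      rw [hι, hκ] at this
      simpa only [Set.image_image] using this

/-! ### Flows, cuts and duality -/

namespace IsTURepresentation

variable {α : Type*} {M : Matroid α} [Fintype M.E] {r : ℕ} {A : Matrix (Fin r) M.E ℤ}

theorem isSupportMatroid_flowLattice (h : M.IsTURepresentation A) :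
    M.IsSupportMatroid (flowLattice A) := fun I => by
  rw [h.indep_iff, supportIndep_flowLattice_iff h.isTotallyUnimodular]

theorem span_range_col (h : M.IsTURepresentation A) :
    Submodule.span ℝ (Set.range (A.map (Int.cast : ℤ → ℝ)).col) = ⊤ := by
  apply Submodule.eq_top_of_finrank_eq
  rw [← Matrix.rank_eq_finrank_span_cols, h.rank_eq, Module.finrank_fin_fun]

theorem isBase_iff (h : M.IsTURepresentation A) (J : Set M.E) :
    M.IsBase (Subtype.val '' J) ↔ LinearIndepOn ℝ (A.map (Int.cast : ℤ → ℝ)).col J ∧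
      Submodule.span ℝ ((A.map (Int.cast : ℤ → ℝ)).col '' J) = ⊤ := by
  refine ⟨fun hJ => ?_, fun ⟨hJ, hspan⟩ => ?_⟩
  · have hli := (h.indep_iff J).1 hJ.indep
    refine ⟨hli, ?_⟩
    rw [eq_top_iff, ← h.span_range_col, Submodule.span_le]
    rintro _ ⟨e, rfl⟩
    by_contra hne
    have h1 := (hli.notMem_span_iff).1 hne
    rw [← h.indep_iff, Set.image_insert_eq] at h1
    exact (hJ.insert_dep ⟨e.2, fun ⟨k, hk, hke⟩ => h1.2 (Subtype.ext hke ▸ hk)⟩).not_indep h1.1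
  · refine ((h.indep_iff J).2 hJ).isBase_of_forall_insert fun e he hins => ?_
    have heJ : (⟨e, he.1⟩ : M.E) ∉ J := fun hJe => he.2 ⟨_, hJe, rfl⟩
    have h1 : insert e (Subtype.val '' J) = Subtype.val '' (insert (⟨e, he.1⟩ : M.E) J) := by
      rw [Set.image_insert_eq]
    rw [h1, h.indep_iff, linearIndepOn_insert heJ, hspan] at hins
    exact hins.2 Submodule.mem_top

/-- The coordinates of pA are the values of the functional p on the columns. A nonzero cut supported
on `I` is thus a functional killing the columns outside `I` but not all columns; none exists exactly
when those columns span, that is, contain a base. -/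
theorem dual_indep_iff (h : M.IsTURepresentation A) (I : Set M.E) :
    M.dual.Indep (Subtype.val '' I) ↔ (cutLattice A).SupportIndep I := by
  classical
  refine Iff.trans ?_ ((hasRounding_span_row h.isTotallyUnimodular).supportIndep_iff I).symm
  have hcol : ∀ (p : Fin r → ℝ) e, (p ᵥ* A.map (Int.cast : ℤ → ℝ)) e =
      p ⬝ᵥ (A.map (Int.cast : ℤ → ℝ)).col e := fun p e => rfl
  rw [dual_indep_iff_exists (by rintro _ ⟨e, -, rfl⟩; exact e.2)]
  refine ⟨fun ⟨B, hB, hIB⟩ z hz hzI => ?_, fun hz => ?_⟩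
  · obtain ⟨p, rfl⟩ := mem_span_row_iff.1 hz
    have hBJ : Subtype.val '' (Subtype.val ⁻¹' B : Set M.E) = B := by
      rw [Subtype.image_preimage_coe, Set.inter_eq_right.2 hB.subset_ground]
    rw [← hBJ, h.isBase_iff] at hB
    have hker : (⊤ : Submodule ℝ (Fin r → ℝ)) ≤ LinearMap.ker (dotProductBilin ℝ ℝ p) := by
      rw [← hB.2, Submodule.span_le]
      rintro _ ⟨e, he, rfl⟩
      exact hzI e fun heI => Set.disjoint_left.1 hIB ⟨e, heI, rfl⟩ he
    ext e
    exact hker (Submodule.mem_top (x := (A.map (Int.cast : ℤ → ℝ)).col e))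
  · obtain ⟨J, hJI, -, hspan, hJ⟩ := exists_linearIndepOn_extension
      (linearIndepOn_empty ℝ (A.map (Int.cast : ℤ → ℝ)).col) (Set.empty_subset Iᶜ)
    refine ⟨Subtype.val '' J, (h.isBase_iff J).2 ⟨hJ, ?_⟩, ?_⟩
    · by_contra hne
      obtain ⟨f, hf0, hf⟩ := Submodule.exists_le_ker_of_lt_top _ (lt_top_iff_ne_top.2 hne)
      let p : Fin r → ℝ := fun i => f fun j => if i = j then 1 else 0
      have hfp : ∀ x, f x = p ⬝ᵥ x := fun x => by
        rw [LinearMap.pi_apply_eq_sum_univ f x, dotProduct]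
        exact Finset.sum_congr rfl fun i _ => mul_comm _ _
      have hp := hz (p ᵥ* A.map (Int.cast : ℤ → ℝ)) (mem_span_row_iff.2 ⟨p, rfl⟩) fun e he => by
        rw [hcol, ← hfp]
        exact hf (hspan ⟨e, he, rfl⟩)
      apply hf0
      rw [← LinearMap.ker_eq_top, eq_top_iff, ← h.span_range_col, Submodule.span_le]
      rintro _ ⟨e, rfl⟩
      change f _ = 0
      rw [hfp, ← hcol, hp]
      rfl
    · rw [Set.disjoint_image_iff Subtype.val_injective]
      exact (Set.disjoint_left.2 fun e he heJ => hJI heJ he)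

end IsTURepresentation

end Matroid

theorem mainTheorem9 {α β : Type*} (M : Matroid α) (N : Matroid β) [Fintype M.E] [Fintype N.E]
    (hM : M.IsRegular) (hN : N.IsRegular) :
    N.deleteLoops.dual = N.dual.contractColoops ∧
    ∀ (r s : ℕ) (A : Matrix (Fin r) M.E ℤ) (B : Matrix (Fin s) N.E ℤ),
      M.IsTURepresentation A → N.IsTURepresentation B →
        (LatticeIsometric (flowLattice A) (cutLattice B) ↔
          M.contractColoops.IsIsomorphic N.deleteLoops.dual) := by
  refine ⟨N.dual_deleteLoops, fun r s A B hA hB => ?_⟩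
  rw [N.dual_deleteLoops]
  -- The dual has definitionally the same ground set, so `cutLattice B` serves as a lattice on it.
  let _ : Fintype N.dual.E := inferInstanceAs (Fintype N.E)
  have hB' : N.dual.IsSupportMatroid (cutLattice B) := hB.dual_indep_iff
  exact hA.isSupportMatroid_flowLattice.latticeIsometric_iff hB'
    (isRegularLattice_flowLattice hA.isTotallyUnimodular)
    (isRegularLattice_cutLattice hB.isTotallyUnimodular)
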